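/- **Theorem.** Let $(R,\mathfrak m)$ be a (Noetherian) Cohen–Macaulay local ring with $\dim R=1$ and total ring of fractions $\mathrm Q(R)$; let $\overline R$ be the integral closure of $R$ in $\mathrm Q(R)$. For a one-dimensional Cohen–Macaulay local ring $(S,\mathfrak n)$ let $\mathrm v(S)=\mu_S(\mathfrak n)$ be the embedding dimension and $\mathrm e(S)=\lim_{n\to\infty}\ell_S(S/\mathfrak n^n)/n$ the multiplicity, where $\mu_S$ is the minimal number of generators and $\ell_S$ the length. An ideal $Q\subseteq I$ is a *reduction* of $I$ if $I^{n+1}=QI^n$ for some $n\ge 0$. An $\mathfrak m$-primary ideal $I$ of $R$ is an *Ulrich ideal* if it contains a parameter ideal $Q=(a)$ as a reduction such that $I\ne Q$, $I^2=QI$, and $I/I^2$ is a free $R/I$-module. For an $R$-submodule $M$ of $\mathrm Q(R)$ put $M:M=\{x\in \mathrm Q(R)\mid xM\subseteq M\}$. Assume that $v:=\mathrm v(R)=\mathrm e(R)>1$ and let $\alpha\in\mathfrak m$ satisfy $\mathfrak m^2=\alpha\mathfrak m$. Let $I$ be an Ulrich ideal of $R$. Then there is a composition series of ideals $$(E)\qquad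 I=I_\ell\subsetneq I_{\ell-1}\subsetneq\cdots\subsetneq I_1=\mathfrak m$$ (that is, no ideal lies strictly between consecutive terms) in which every $I_i$ is an Ulrich ideal. For every such series, $\ell=\ell_R(R/I)$. Set $B_0=R$ and $B_i=I_i:I_i$ for $1\le i\le \ell$, and let $\mathfrak n_i$ be the Jacobson radical of $B_i$ for $0\le i\le\ell$. Then $$R=B_0\subsetneq B_1\subsetneq\cdots\subsetneq B_{\ell-1}\subsetneq B_\ell\subseteq\overline R$$ is a tower of birational finite extensions of $R$, and the following hold. 1. $(\alpha^i)$ is a reduction of $I_i$ for every $1\le i\le \ell$. 2. $B_i=\mathfrak n_{i-1}:\mathfrak n_{i-1}$ for every $1\le i\le\ell$. 3. For $0\le i\le \ell-1$, $(B_i,\mathfrak n_i)$ is a one-dimensional Cohen–Macaulay local ring with $\mathrm v(B_i)=\mathrm e(B_i)=\mathrm e(R)>1$ and $\mathfrak n_i^2=\alpha\mathfrak n_i$. 4. There are $x_2,\dots,x_v\in I$ with $I=(\alpha^\ell,x_2,\dots,x_v)$, and for every such choice $I_i=(\alpha^i,x_2,\dots,x_v)$ for all $1\le i\le \ell$; in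 particular $\mathfrak m=(\alpha,x_2,\dots,x_v)$. The series $(E)$ is the unique composition series of ideals of $R$ connecting $I$ and $\mathfrak m$. 5. If $J$ is an ideal of $R$ with $I\subseteq J\subseteq\mathfrak m$, then $J=I_i$ for some $1\le i\le\ell$. -/

import Mathlib

open IsLocalRing Filter Topology
open scoped nonZeroDivisors ENNReal

noncomputable section

namespace UlrichChain

section General

variable {R : Type*} [CommRing R]

/-- `Q` is a reduction of `I`: `Q ⊆ I` and `I ^ (n + 1) = Q I ^ n` for some `n ≥ 0`. -/
def IsReduction (Q I : Ideal R) : Prop :=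
  Q ≤ I ∧ ∃ n : ℕ, I ^ (n + 1) = Q * I ^ n

end General

section Local

variable (R : Type*) [CommRing R] [IsLocalRing R]

/-- A Noetherian local ring is Cohen-Macaulay if its maximal ideal contains a regular sequence
whose length is the Krull dimension. -/
def IsCohenMacaulayLocal : Prop :=
  IsNoetherianRing R ∧ ∃ rs : List R, (∀ r ∈ rs, r ∈ maximalIdeal R) ∧
    RingTheory.Sequence.IsRegular R rs ∧ ringKrullDim R = (rs.length : WithBot ℕ∞)

/-- The embedding dimension `v(R)`: the minimal number of generators of the maximal ideal. -/
def embDim : ℕ := (maximalIdeal R).spanFinrank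

/-- For a local ring of dimension one: the multiplicity `e(R) = lim ℓ_R(R / 𝔪 ^ n) / n` exists
and equals `e`. -/
def HasMultiplicity (e : ℕ) : Prop :=
  Tendsto (fun n : ℕ => ((Module.length R (R ⧸ maximalIdeal R ^ n) : ℕ∞) : ℝ≥0∞) / (n : ℝ≥0∞))
    atTop (𝓝 (e : ℝ≥0∞))

variable {R}

/-- A parameter ideal: an `𝔪`-primary ideal generated by `dim R` elements. -/
def IsParameterIdeal (Q : Ideal R) : Prop :=
  Q.radical = maximalIdeal R ∧
    ∃ (d : ℕ) (a : Fin d → R), ringKrullDim R = (d : WithBot ℕ∞) ∧ Q = Ideal.span (Set.range a)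

/-- Ulrich ideals: `𝔪`-primary ideals `I` containing a parameter ideal `Q` as a reduction such that
`I ≠ Q`, `I ^ 2 = Q I`, and `I / I ^ 2` is a free `R / I`-module. -/
structure IsUlrich (I : Ideal R) : Prop where
  radical_eq : I.radical = maximalIdeal R
  exists_reduction : ∃ Q : Ideal R,
    IsParameterIdeal Q ∧ IsReduction Q I ∧ I ≠ Q ∧ I ^ 2 = Q * I
  free : Module.Free (R ⧸ I) I.Cotangent

/-- `I = c ℓ ⊊ c (ℓ - 1) ⊊ ⋯ ⊊ c 1 = 𝔪` is a composition series of ideals connecting `I` and `𝔪`;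
only the values `c 1, …, c ℓ` matter. -/
structure IsCompSeries (I : Ideal R) (ℓ : ℕ) (c : ℕ → Ideal R) : Prop where
  one_le : 1 ≤ ℓ
  first : c 1 = maximalIdeal R
  last : c ℓ = I
  covBy : ∀ i, 1 ≤ i → i < ℓ → c (i + 1) ⋖ c i

end Local

section Overrings

variable {R : Type*} [CommRing R] {K : Type*} [CommRing K] [Algebra R K]

/-- `M : M = {x ∈ K | x M ⊆ M}`, as a subalgebra of `K`. -/
def selfColon (M : Submodule R K) : Subalgebra R K where
  carrier := {x | ∀ y ∈ M, x * y ∈ M}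
  mul_mem' {a b} ha hb y hy := by
    rw [mul_assoc]
    exact ha _ (hb _ hy)
  add_mem' {a b} ha hb y hy := by
    rw [add_mul]
    exact M.add_mem (ha _ hy) (hb _ hy)
  algebraMap_mem' r y hy := by
    rw [← Algebra.smul_def]
    exact M.smul_mem r hy

/-- The Jacobson radical of a subring `B` of `K`, as an ideal of `B`. -/
def jacobsonRadical (B : Subalgebra R K) : Ideal B := Ideal.jacobson ⊥

/-- The Jacobson radical of a subring `B` of `K`, as an `R`-submodule of `K`. -/
def jacobsonSubmodule (B : Subalgebra R K) : Submodule R K :=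
  ((jacobsonRadical B).restrictScalars R).map B.val.toLinearMap

variable (K) in
/-- `B 0 = R` and `B i = c i : c i` (computed in `K`) for `i ≥ 1`. -/
def overring (c : ℕ → Ideal R) : ℕ → Subalgebra R K
  | 0 => ⊥
  | i + 1 => selfColon (IsLocalization.coeSubmodule K (c (i + 1)))

end Overrings

end UlrichChain

end

/-!
Let `a` generate a principal reduction of the Ulrich ideal `I` with `I² = aI`, and complete `a` to a
basis of `I / I²` over `R / I`. For `w ∈ 𝔪` and a further basis element `x`, the relation `𝔪² = α𝔪`
produces `u, v` with `αv = wa` and `αu = wx`, so `ua = vx`, and freeness of `I / I²` forces `v ∈ I`.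
Hence `𝔪a ⊆ αI`, which yields both `𝔪 = (α) + I` and `𝔪I = αI`. The second identity allows powers of
`α` to be factored out of `I²` until `α ^ ℓ ∈ I`, so `I² = α ^ ℓ I`, and `a` may be replaced by
`α ^ ℓ`.

Because `𝔪 = (α) + I`, the ideals above `I` are exactly the `I_i = (α ^ i) + I`, and they satisfy
`I_i I_j = α ^ i I_j` for `i ≤ j ≤ ℓ`. Therefore `B_i = α ^ (-i) I_i`, its maximal ideal is
`𝔫_i = α ^ (-i) I_{i + 1}`, and `I_{i + 1}² = α ^ (i + 1) I_{i + 1}` turns into `𝔫_i² = α𝔫_i`.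
A basis `α ^ ℓ, x_2, …, x_v` of `I / I²` induces the basis `α ^ i, x_2, …, x_v` of `I_i / I_i²`,
and, after division by `α ^ i`, a basis of `𝔫_i / 𝔫_i²`. Finally, in a local ring with `𝔫² = α𝔫`
and `α` regular, the length of `S / 𝔫 ^ (k + 1)` is `k v(S) + 1`, so `e(S) = v(S)`.
-/

namespace UlrichChain

section Length

variable {R : Type*} [CommRing R]

theorem length_quotient_eq_add_of_le {M : Type*} [AddCommGroup M] [Module R M]
    {N P : Submodule R M} (h : N ≤ P) : Module.length R (M ⧸ N) =
      Module.length R (P ⧸ N.submoduleOf P) + Module.length R (M ⧸ P) := by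
  have hle : N.submoduleOf P ≤ N.comap P.subtype := le_rfl
  refine Module.length_eq_add_of_exact (Submodule.mapQ _ N P.subtype hle)
    (Submodule.factor h) ?_ (Submodule.factor_surjective h) ?_
  · rw [← LinearMap.ker_eq_bot]
    exact Submodule.ker_liftQ_eq_bot _ _ _ (by rw [LinearMap.ker_comp, Submodule.ker_mkQ]; rfl)
  · rw [LinearMap.exact_iff, Submodule.range_mapQ, Submodule.range_subtype, Submodule.factor,
      Submodule.mapQ, Submodule.ker_liftQ, LinearMap.comp_id, Submodule.ker_mkQ]

theorem length_quotient_of_covBy {N M : Ideal R} (h : N ⋖ M) :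
    Module.length R (R ⧸ N) = Module.length R (R ⧸ M) + 1 := by
  have : IsSimpleModule R (M ⧸ N.submoduleOf M) := (covBy_iff_quot_is_simple h.le).1 h
  rw [length_quotient_eq_add_of_le h.le, Module.length_eq_one, add_comm]

theorem length_quotient_span_singleton_mul {a : R} (ha : a ∈ R⁰) (J : Ideal R) :
    Module.length R (R ⧸ Ideal.span {a} * J) =
      Module.length R (R ⧸ J) + Module.length R (R ⧸ Ideal.span {a}) := by
  rw [← smul_eq_mul, Submodule.ideal_span_singleton_smul]
  exact Module.length_eq_add_of_exact _ _ (Ideal.mulQuot_injective J ha)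
    (Ideal.quotOfMul_surjective J) (Ideal.exact_mulQuot_quotOfMul J)

theorem length_quotient_sq (I : Ideal R) : Module.length R (R ⧸ I ^ 2) =
    Module.length R I.Cotangent + Module.length R (R ⧸ I) := by
  have hI : I • ⊤ = (I ^ 2).submoduleOf I := Submodule.map_injective_of_injective
    I.subtype_injective (by
      rw [Submodule.map_smul'', Submodule.map_subtype_top, smul_eq_mul, ← sq,
        Submodule.submoduleOf, Submodule.map_comap_subtype,
        inf_eq_right.2 (Ideal.pow_le_self two_ne_zero)])
  rw [length_quotient_eq_add_of_le (Ideal.pow_le_self two_ne_zero)]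
  congr 1
  exact (Submodule.quotEquivOfEq _ _ hI).length_eq.symm

end Length

section MinimalMultiplicity

variable {S : Type*} [CommRing S] [IsLocalRing S] {α : S}

theorem length_quotient_maximalIdeal : Module.length S (S ⧸ maximalIdeal S) = 1 :=
  Module.length_eq_one_iff.2 (isSimpleModule_iff_isCoatom.2 (maximalIdeal.isMaximal S).out)

variable [IsNoetherianRing S]

theorem length_cotangentSpace : Module.length S (CotangentSpace S) = embDim S := by
  rw [embDim, spanFinrank_maximalIdeal_eq_finrank_cotangentSpace,
    ← Module.length_eq_finrank (ResidueField S)]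
  exact Module.length_eq_of_surjective residue_surjective

theorem length_quotient_span_singleton (hreg : α ∈ S⁰)
    (hα2 : maximalIdeal S ^ 2 = Ideal.span {α} * maximalIdeal S) :
    Module.length S (S ⧸ Ideal.span {α}) = embDim S := by
  have h : Module.length S (CotangentSpace S) + 1 = 1 + Module.length S (S ⧸ Ideal.span {α}) := by
    rw [← length_quotient_maximalIdeal (S := S), ← length_quotient_sq, hα2,
      length_quotient_span_singleton_mul hreg]
  rw [add_comm, length_cotangentSpace] at h
  exact (ENat.add_right_injective_of_ne_top ENat.one_ne_top h).symm

theorem length_quotient_maximalIdeal_pow (hreg : α ∈ S⁰)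
    (hα2 : maximalIdeal S ^ 2 = Ideal.span {α} * maximalIdeal S) (k : ℕ) :
    Module.length S (S ⧸ maximalIdeal S ^ (k + 1)) = k * embDim S + 1 := by
  induction k with
  | zero => rw [zero_add, pow_one, length_quotient_maximalIdeal, Nat.cast_zero, zero_mul, zero_add]
  | succ k ih =>
    have hpow : maximalIdeal S ^ (k + 2) = Ideal.span {α} * maximalIdeal S ^ (k + 1) := by
      rw [add_comm, pow_add, hα2, mul_assoc, ← pow_succ']
    rw [hpow, length_quotient_span_singleton_mul hreg, ih, length_quotient_span_singleton hreg hα2,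
      Nat.cast_succ]
    ring

theorem hasMultiplicity_embDim (hreg : α ∈ S⁰)
    (hα2 : maximalIdeal S ^ 2 = Ideal.span {α} * maximalIdeal S) :
    HasMultiplicity S (embDim S) := by
  have hlim : Tendsto (fun k : ℕ => (1 + embDim S * k : NNReal) / (1 + 1 * k)) atTop
      (𝓝 (embDim S / 1)) := tendsto_add_mul_div_add_mul_atTop_nhds _ _ _ one_ne_zero
  rw [div_one] at hlim
  rw [HasMultiplicity, ← tendsto_add_atTop_iff_nat 1]
  refine (ENNReal.tendsto_coe.2 hlim).congr fun k => ?_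
  rw [length_quotient_maximalIdeal_pow hreg hα2, ENNReal.coe_div (by positivity)]
  push_cast
  ring_nf

theorem ringKrullDim_eq_one_of_sq_eq (hα : α ∈ maximalIdeal S) (hreg : α ∈ S⁰)
    (hα2 : maximalIdeal S ^ 2 = Ideal.span {α} * maximalIdeal S) : ringKrullDim S = 1 := by
  rw [← ringKrullDim_quotient_span_singleton_succ_eq_ringKrullDim_of_mem_nonZeroDivisors hreg hα]
  have hne : Ideal.span {α} ≠ ⊤ := Ideal.span_singleton_eq_top.not.2 hα
  have : Nontrivial (S ⧸ Ideal.span {α}) := Ideal.Quotient.nontrivial_iff.2 hne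
  have hnil : ∀ x : S ⧸ Ideal.span {α}, IsNilpotent x ↔ ¬ IsUnit x := by
    refine fun x => ⟨fun hx hu => hu.not_isNilpotent hx, fun hx => ?_⟩
    obtain ⟨s, rfl⟩ := Ideal.Quotient.mk_surjective x
    have hs : s ∈ maximalIdeal S := fun hu => hx (hu.map _)
    refine ⟨2, ?_⟩
    rw [← map_pow, Ideal.Quotient.eq_zero_iff_mem]
    exact Ideal.mul_le_left (hα2 ▸ Ideal.pow_mem_pow hs 2)
  have : Ring.KrullDimLE 0 (S ⧸ Ideal.span {α}) ∧ IsLocalRing (S ⧸ Ideal.span {α}) :=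
    ((Ring.krullDimLE_zero_and_isLocalRing_tfae _).out 2 0).1 hnil
  rw [ringKrullDimZero_iff_ringKrullDim_eq_zero.1 this.1, zero_add]

theorem isCohenMacaulayLocal_of_sq_eq (hα : α ∈ maximalIdeal S) (hreg : α ∈ S⁰)
    (hα2 : maximalIdeal S ^ 2 = Ideal.span {α} * maximalIdeal S) : IsCohenMacaulayLocal S := by
  have hmem : ∀ r ∈ [α], r ∈ maximalIdeal S := by simpa using hα
  refine ⟨inferInstance, [α], hmem, ?_, ringKrullDim_eq_one_of_sq_eq hα hreg hα2⟩
  rw [isRegular_iff_isWeaklyRegular_of_subset_maximalIdeal hmem,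
    RingTheory.Sequence.isWeaklyRegular_singleton_iff]
  exact fun x y h => (mul_cancel_left_mem_nonZeroDivisors hreg).1 h

end MinimalMultiplicity

section CompositionSeries

variable {R : Type*} [CommRing R] [IsLocalRing R] {I : Ideal R} {ℓ : ℕ} {c : ℕ → Ideal R}

theorem IsCompSeries.length_quotient (hc : IsCompSeries I ℓ c) {i : ℕ} (hi1 : 1 ≤ i) (hi : i ≤ ℓ) :
    Module.length R (R ⧸ c i) = i := by
  induction i, hi1 using Nat.le_induction with
  | base => rw [hc.first, length_quotient_maximalIdeal, Nat.cast_one]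
  | succ i hi1 ih =>
    rw [length_quotient_of_covBy (hc.covBy i hi1 hi), ih (Nat.le_of_succ_le hi), Nat.cast_succ]

theorem IsCompSeries.anti (hc : IsCompSeries I ℓ c) {i j : ℕ} (hi : 1 ≤ i) (hij : i ≤ j)
    (hj : j ≤ ℓ) : c j ≤ c i := by
  induction j, hij using Nat.le_induction with
  | base => exact le_rfl
  | succ j hij ih => exact (hc.covBy j (hi.trans hij) hj).le.trans (ih (Nat.le_of_succ_le hj))

theorem IsCompSeries.unique (hc : IsCompSeries I ℓ c)
    (hall : ∀ J, I ≤ J → J ≤ maximalIdeal R → ∃ i, 1 ≤ i ∧ i ≤ ℓ ∧ J = c i)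
    {n : ℕ} {d : ℕ → Ideal R} (hd : IsCompSeries I n d) :
    n = ℓ ∧ ∀ i, 1 ≤ i → i ≤ ℓ → d i = c i := by
  have hn : n = ℓ := by
    have hI := hd.length_quotient hd.one_le le_rfl
    rw [hd.last, ← hc.last, hc.length_quotient hc.one_le le_rfl] at hI
    exact_mod_cast hI.symm
  subst hn
  refine ⟨rfl, fun i hi1 hi => ?_⟩
  obtain ⟨k, hk1, hk, hdk⟩ :=
    hall (d i) (hd.last ▸ hd.anti hi1 hi le_rfl) (hd.first ▸ hd.anti le_rfl hi1 hi)
  have hik : (i : ℕ∞) = k := by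
    rw [← hd.length_quotient hi1 hi, hdk, hc.length_quotient hk1 hk]
  rw [hdk, Nat.cast_injective hik]

end CompositionSeries

section CotangentBasis

variable {R : Type*} [CommRing R] {I : Ideal R} {ι : Type*} [Fintype ι] {w : ι → R}

/-- Generators `w` of an ideal `I` whose classes form a basis of the `R / I`-module `I / I ^ 2`. -/
structure IsCotangentBasis (I : Ideal R) (w : ι → R) : Prop where
  span_range_eq : Ideal.span (Set.range w) = I
  mem_of_sum_mem_sq : ∀ r : ι → R, ∑ j, r j * w j ∈ I ^ 2 → ∀ j, r j ∈ I

theorem sum_mk_smul_toCotangent (v : ι → I) (r : ι → R) :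
    ∑ j, Ideal.Quotient.mk I (r j) • I.toCotangent (v j) = I.toCotangent (∑ j, r j • v j) := by
  rw [map_sum]
  exact Finset.sum_congr rfl fun j _ => by
    rw [map_smul]; exact algebraMap_smul (R ⧸ I) (r j) (I.toCotangent (v j))

namespace IsCotangentBasis

theorem mem (hw : IsCotangentBasis I w) (j : ι) : w j ∈ I :=
  hw.span_range_eq ▸ Ideal.subset_span ⟨j, rfl⟩

theorem exists_eq_sum (hw : IsCotangentBasis I w) {y : R} (hy : y ∈ I) :
    ∃ r : ι → R, y = ∑ j, r j * w j := by
  rw [← hw.span_range_eq, Ideal.mem_span_range_iff_exists_fun] at hy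
  exact hy.imp fun r hr => hr.symm

theorem nonempty_basis (hw : IsCotangentBasis I w) :
    Nonempty (Module.Basis ι (R ⧸ I) I.Cotangent) := by
  let v : ι → I := fun j => ⟨w j, hw.mem j⟩
  have hv (r : ι → R) : ((∑ j, r j • v j : I) : R) = ∑ j, r j * w j := by simp [v]
  refine ⟨Module.Basis.mk (v := fun j => I.toCotangent (v j)) ?_ ?_⟩
  · rw [Fintype.linearIndependent_iff]
    intro g hg j
    choose r hr using fun j => Ideal.Quotient.mk_surjective (g j)
    simp only [← hr, sum_mk_smul_toCotangent, Ideal.toCotangent_eq_zero, hv] at hg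
    rw [← hr, Ideal.Quotient.eq_zero_iff_mem]
    exact hw.mem_of_sum_mem_sq r hg j
  · rintro y -
    obtain ⟨⟨x, hx⟩, rfl⟩ := I.toCotangent_surjective y
    obtain ⟨r, hr⟩ := hw.exists_eq_sum hx
    rw [show (⟨x, hx⟩ : I) = ∑ j, r j • v j from Subtype.ext (hr.trans (hv r).symm),
      ← sum_mk_smul_toCotangent]
    exact Submodule.sum_mem _ fun j _ => Submodule.smul_mem _ _ (Submodule.subset_span ⟨j, rfl⟩)

theorem free (hw : IsCotangentBasis I w) : Module.Free (R ⧸ I) I.Cotangent :=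
  let ⟨b⟩ := hw.nonempty_basis
  .of_basis b

theorem embDim_eq_card [IsLocalRing R] [IsNoetherianRing R]
    (hw : IsCotangentBasis (maximalIdeal R) w) : embDim R = Fintype.card ι := by
  obtain ⟨b⟩ := hw.nonempty_basis
  rw [embDim, spanFinrank_maximalIdeal_eq_finrank_cotangentSpace]
  exact Module.finrank_eq_card_basis (R := ResidueField R) b

theorem reindex {κ : Type*} [Fintype κ] (hw : IsCotangentBasis I w) (σ : κ ≃ ι) :
    IsCotangentBasis I (w ∘ σ) where
  span_range_eq := by rw [σ.surjective.range_comp, hw.span_range_eq]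
  mem_of_sum_mem_sq r hr j := by
    rw [← σ.symm_apply_apply j]
    refine hw.mem_of_sum_mem_sq (r ∘ σ.symm) ?_ (σ j)
    rw [← σ.sum_comp]
    simpa only [Function.comp_apply, σ.symm_apply_apply] using hr

theorem of_algebraMap {S : Type*} [CommRing S] [Algebra R S] {J : Ideal S} {w : ι → S}
    (hspan : Ideal.span (Set.range w) = J) (hsurj : ∀ s : S, ∃ r : R, s - algebraMap R S r ∈ J)
    (hrel : ∀ r : ι → R, ∑ j, algebraMap R S (r j) * w j ∈ J ^ 2 → ∀ j, algebraMap R S (r j) ∈ J) :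
    IsCotangentBasis J w := by
  refine ⟨hspan, fun s hs j => ?_⟩
  choose r hr using fun j => hsurj (s j)
  have hdiff : ∑ j, (s j - algebraMap R S (r j)) * w j ∈ J ^ 2 := Ideal.sum_mem _ fun j _ => by
    rw [sq]
    exact Ideal.mul_mem_mul (hr j) (hspan ▸ Ideal.subset_span ⟨j, rfl⟩)
  have hsum : ∑ j, algebraMap R S (r j) * w j ∈ J ^ 2 := by
    simpa only [sub_mul, Finset.sum_sub_distrib, sub_sub_cancel] using sub_mem hs hdiff
  rw [← sub_add_cancel (s j) (algebraMap R S (r j))]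
  exact add_mem (hr j) (hrel r hsum j)

variable {n : ℕ} {b : R} {x : Fin n → R}

theorem cons_iff : IsCotangentBasis I (Fin.cons b x : Fin (n + 1) → R) ↔
    Ideal.span (insert b (Set.range x)) = I ∧
      ∀ (t : R) (s : Fin n → R), t * b + ∑ j, s j * x j ∈ I ^ 2 → t ∈ I ∧ ∀ j, s j ∈ I := by
  rw [← Fin.range_cons]
  refine ⟨fun hw => ⟨hw.span_range_eq, fun t s h => ?_⟩,
    fun ⟨hspan, hrel⟩ => ⟨hspan, fun r hr => ?_⟩⟩
  · have hmem := hw.mem_of_sum_mem_sq (Fin.cons t s) (by simpa [Fin.sum_univ_succ] using h)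
    exact ⟨hmem 0, fun j => hmem j.succ⟩
  · obtain ⟨h0, hsucc⟩ := hrel (r 0) (Fin.tail r) (by
      simpa [Fin.sum_univ_succ, Fin.tail] using hr)
    exact Fin.cases h0 hsucc

theorem exists_eq_mul_add_sum (hw : IsCotangentBasis I (Fin.cons b x : Fin (n + 1) → R)) {y : R}
    (hy : y ∈ I) : ∃ (t : R) (s : Fin n → R), y = t * b + ∑ j, s j * x j := by
  obtain ⟨r, hr⟩ := hw.exists_eq_sum hy
  exact ⟨r 0, Fin.tail r, by simpa [Fin.sum_univ_succ, Fin.tail] using hr⟩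

theorem mem_head (hw : IsCotangentBasis I (Fin.cons b x : Fin (n + 1) → R)) : b ∈ I := hw.mem 0

theorem mem_tail (hw : IsCotangentBasis I (Fin.cons b x : Fin (n + 1) → R)) (j : Fin n) :
    x j ∈ I := hw.mem j.succ

theorem eq_span_singleton_iff (hw : IsCotangentBasis I (Fin.cons b x : Fin (n + 1) → R))
    (hI : I ≠ ⊤) : I = Ideal.span {b} ↔ n = 0 := by
  constructor
  · intro h
    by_contra! hn
    let j : Fin n := ⟨0, Nat.pos_of_ne_zero hn⟩
    obtain ⟨s, hs⟩ := Ideal.mem_span_singleton'.1 (h ▸ hw.mem_tail j)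
    have hrel : -s * b + ∑ k, (Pi.single j 1 : Fin n → R) k * x k = 0 := by
      rw [Fintype.sum_eq_single j fun k hk => by rw [Pi.single_eq_of_ne hk, zero_mul],
        Pi.single_eq_same, ← hs]
      ring
    have h1 := ((cons_iff.1 hw).2 _ _ (hrel ▸ zero_mem _)).2 j
    rw [Pi.single_eq_same] at h1
    exact hI ((Ideal.eq_top_iff_one I).2 h1)
  · rintro rfl
    rw [← hw.span_range_eq, Fin.range_cons, Set.range_eq_empty, insert_empty_eq]

theorem exchange (hw : IsCotangentBasis I (Fin.cons b x : Fin (n + 1) → R)) {c : R}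
    (hc : IsUnit c) (d : Fin n → R) :
    IsCotangentBasis I (Fin.cons (c * b + ∑ j, d j * x j) x : Fin (n + 1) → R) := by
  obtain ⟨hspan, hrel⟩ := cons_iff.1 hw
  have hd : ∑ j, d j * x j ∈ Ideal.span (Set.range x) :=
    Ideal.mem_span_range_iff_exists_fun.2 ⟨d, rfl⟩
  refine cons_iff.2 ⟨?_, fun t s h => ?_⟩
  · rw [← hspan, Ideal.span_insert, Ideal.span_insert]
    refine le_antisymm (sup_le ?_ le_sup_right) (sup_le ?_ le_sup_right) <;>
      rw [Ideal.span_singleton_le_iff_mem]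
    · exact add_mem (Ideal.mem_sup_left (Ideal.mem_span_singleton'.2 ⟨c, rfl⟩))
        (Ideal.mem_sup_right hd)
    · rw [← Ideal.unit_mul_mem_iff_mem _ hc]
      exact (Submodule.add_mem_iff_left _ (Ideal.mem_sup_right hd)).1
        (Ideal.mem_sup_left (Ideal.mem_span_singleton_self _))
  · obtain ⟨htc, hts⟩ := hrel (t * c) (fun j => t * d j + s j) (by
      convert h using 1
      simp only [add_mul, Finset.sum_add_distrib, mul_add, Finset.mul_sum, mul_assoc, add_assoc])
    have ht : t ∈ I := (Ideal.mul_unit_mem_iff_mem I hc).1 htc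
    exact ⟨ht, fun j => (Submodule.add_mem_iff_right _ (Ideal.mul_mem_right _ _ ht)).1 (hts j)⟩

end IsCotangentBasis

variable [IsLocalRing R] [IsNoetherianRing R]

theorem exists_isCotangentBasis (hI : I ≤ maximalIdeal R) [Module.Free (R ⧸ I) I.Cotangent] :
    ∃ (n : ℕ) (w : Fin n → R), IsCotangentBasis I w := by
  have : Nontrivial (R ⧸ I) :=
    Ideal.Quotient.nontrivial_iff.2 (ne_top_of_le_ne_top Ideal.IsPrime.ne_top' hI)
  have : Module.Finite (R ⧸ I) I.Cotangent :=
    have : Module.Finite R I.Cotangent := .of_surjective I.toCotangent I.toCotangent_surjective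
    .of_restrictScalars_finite R _ _
  obtain ⟨N, f⟩ : Σ N, Module.Basis (Fin N) (R ⧸ I) I.Cotangent :=
    ⟨_, Module.finBasis (R ⧸ I) I.Cotangent⟩
  choose v hv using fun j => I.toCotangent_surjective (f j)
  have hsum (r : Fin N → R) :
      ∑ j, Ideal.Quotient.mk I (r j) • f j = I.toCotangent (∑ j, r j • v j) := by
    simp only [← hv, sum_mk_smul_toCotangent]
  have hcoe (r : Fin N → R) : ((∑ j, r j • v j : I) : R) = ∑ j, r j * (v j : R) := by simp
  refine ⟨_, fun j => v j, le_antisymm ?_ ?_, fun r hr j => ?_⟩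
  · exact Ideal.span_le.2 (Set.range_subset_iff.2 fun j => (v j).2)
  · refine Submodule.le_of_le_smul_of_le_jacobson_bot (IsNoetherian.noetherian I)
      (hI.trans (maximalIdeal_le_jacobson ⊥)) fun y hy => ?_
    choose r hr using fun j => Ideal.Quotient.mk_surjective (f.repr (I.toCotangent ⟨y, hy⟩) j)
    have hy2 : y - ∑ j, r j * (v j : R) ∈ I ^ 2 := by
      rw [← hcoe, ← Ideal.toCotangent_eq (x := ⟨y, hy⟩), ← hsum]
      simp only [hr, f.sum_repr]
    rw [← sub_add_cancel y (∑ j, r j * (v j : R)), add_comm, smul_eq_mul, ← sq]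
    exact Submodule.add_mem_sup (Ideal.mem_span_range_iff_exists_fun.2 ⟨r, rfl⟩) hy2
  · rw [← hcoe, ← Ideal.toCotangent_eq_zero, ← hsum] at hr
    rw [← Ideal.Quotient.eq_zero_iff_mem]
    exact Fintype.linearIndependent_iff.1 f.linearIndependent _ hr j

theorem exists_isCotangentBasis_cons (hI : I ≤ maximalIdeal R) [Module.Free (R ⧸ I) I.Cotangent]
    {b : R} (hb : b ∈ I) (hbm : b ∉ maximalIdeal R * I) :
    ∃ (n : ℕ) (x : Fin n → R), IsCotangentBasis I (Fin.cons b x : Fin (n + 1) → R) := by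
  obtain ⟨n, w, hw⟩ := exists_isCotangentBasis hI
  obtain ⟨c, rfl⟩ := hw.exists_eq_sum hb
  obtain ⟨j, hj⟩ : ∃ j, c j ∉ maximalIdeal R := by
    by_contra! h
    exact hbm (Ideal.sum_mem _ fun j _ => Ideal.mul_mem_mul (h j) (hw.mem j))
  cases n with
  | zero => exact j.elim0
  | succ n =>
    let σ := Equiv.swap 0 j
    have h0 : IsUnit (c (σ 0)) := by simpa [σ] using hj
    have hwσ := hw.reindex σ
    rw [← Fin.cons_self_tail (w ∘ σ)] at hwσ
    rw [← Equiv.sum_comp σ, Fin.sum_univ_succ]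
    exact ⟨n, _, hwσ.exchange h0 fun j => c (σ j.succ)⟩

end CotangentBasis

section PowerReduction

variable {R : Type*} [CommRing R] [IsLocalRing R] {α a : R} {I : Ideal R} {n : ℕ} {x : Fin n → R}

theorem notMem_maximalIdeal_mul [IsNoetherianRing R] {b : R} (hb : b ∈ R⁰) (hbI : b ∈ I)
    (hsq : I ^ 2 = Ideal.span {b} * I) : b ∉ maximalIdeal R * I := by
  intro h
  have hle : I ^ 2 ≤ maximalIdeal R • I ^ 2 := by
    rw [smul_eq_mul, sq, ← mul_assoc, ← sq, hsq]
    exact Ideal.mul_mono_left ((Ideal.span_singleton_le_iff_mem _).2 h)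
  have hbot := Submodule.eq_bot_of_le_smul_of_le_jacobson_bot _ _ (IsNoetherian.noetherian (I ^ 2))
    hle (maximalIdeal_le_jacobson ⊥)
  have hb2 : b ^ 2 ∈ I ^ 2 := Ideal.pow_mem_pow hbI 2
  rw [hbot, Ideal.mem_bot] at hb2
  exact zero_notMem_nonZeroDivisors (hb2 ▸ pow_mem hb 2)

namespace IsCotangentBasis

theorem exists_mul_eq_mul (hw : IsCotangentBasis I (Fin.cons a x : Fin (n + 1) → R)) (hn : n ≠ 0)
    (hI : I ≤ maximalIdeal R) (hα0 : α ∈ R⁰)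
    (hα2 : maximalIdeal R ^ 2 = Ideal.span {α} * maximalIdeal R) {w : R}
    (hwm : w ∈ maximalIdeal R) : ∃ v ∈ I, α * v = w * a := by
  have hmul {y : R} (hy : y ∈ I) : ∃ v ∈ maximalIdeal R, α * v = w * y := by
    rw [← Ideal.mem_span_singleton_mul, ← hα2, sq]
    exact Ideal.mul_mem_mul hwm (hI hy)
  let j : Fin n := ⟨0, Nat.pos_of_ne_zero hn⟩
  obtain ⟨v, -, hv⟩ := hmul hw.mem_head
  obtain ⟨u, -, hu⟩ := hmul (hw.mem_tail j)
  -- Multiplied by `α` both sides become `w a x_j`.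
  have huv : u * a = v * x j := by
    rw [← mul_cancel_left_mem_nonZeroDivisors hα0]
    linear_combination a * hu - x j * hv
  have hrel : -u * a + ∑ k, (Pi.single j v : Fin n → R) k * x k = 0 := by
    rw [Fintype.sum_eq_single j fun k hk => by rw [Pi.single_eq_of_ne hk, zero_mul],
      Pi.single_eq_same, ← huv]
    ring
  have hmem := ((cons_iff.1 hw).2 _ _ (hrel ▸ zero_mem _)).2 j
  rw [Pi.single_eq_same] at hmem
  exact ⟨v, hmem, hv⟩

theorem maximalIdeal_mul_eq (hw : IsCotangentBasis I (Fin.cons a x : Fin (n + 1) → R))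
    (hn : n ≠ 0) (hI : I ≤ maximalIdeal R) (hα : α ∈ maximalIdeal R) (hα0 : α ∈ R⁰)
    (hα2 : maximalIdeal R ^ 2 = Ideal.span {α} * maximalIdeal R) (ha0 : a ∈ R⁰)
    (hsq : I ^ 2 = Ideal.span {a} * I) : maximalIdeal R * I = Ideal.span {α} * I := by
  refine le_antisymm (Ideal.mul_le.2 fun w hwm y hy => ?_)
    (Ideal.mul_mono_left ((Ideal.span_singleton_le_iff_mem _).2 hα))
  obtain ⟨v, hvI, hv⟩ := hw.exists_mul_eq_mul hn hI hα0 hα2 hwm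
  obtain ⟨u, -, hu⟩ : ∃ u ∈ maximalIdeal R, α * u = w * y := by
    rw [← Ideal.mem_span_singleton_mul, ← hα2, sq]
    exact Ideal.mul_mem_mul hwm (hI hy)
  obtain ⟨u', hu'I, hu'⟩ : ∃ u' ∈ I, a * u' = v * y := by
    rw [← Ideal.mem_span_singleton_mul, ← hsq, sq]
    exact Ideal.mul_mem_mul hvI hy
  have huu' : u' = u := by
    rw [← mul_cancel_left_mem_nonZeroDivisors (mul_mem hα0 ha0)]
    linear_combination α * hu' - a * hu + y * hv
  exact Ideal.mem_span_singleton_mul.2 ⟨u, huu' ▸ hu'I, hu⟩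

theorem maximalIdeal_eq_sup (hw : IsCotangentBasis I (Fin.cons a x : Fin (n + 1) → R))
    (hn : n ≠ 0) (hI : I ≤ maximalIdeal R) (hα : α ∈ maximalIdeal R) (hα0 : α ∈ R⁰)
    (hα2 : maximalIdeal R ^ 2 = Ideal.span {α} * maximalIdeal R) :
    maximalIdeal R = Ideal.span {α} ⊔ I := by
  refine le_antisymm (fun w hwm => ?_) (sup_le ((Ideal.span_singleton_le_iff_mem _).2 hα) hI)
  obtain ⟨v, hvI, hv⟩ := hw.exists_mul_eq_mul hn hI hα0 hα2 hwm
  obtain ⟨t, s, rfl⟩ := hw.exists_eq_mul_add_sum hvI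
  have hrel : (w - α * t) * a + ∑ j, -(α * s j) * x j = 0 := by
    simp only [neg_mul, Finset.sum_neg_distrib, mul_assoc, ← Finset.mul_sum]
    linear_combination -hv
  have hmem := ((cons_iff.1 hw).2 _ _ (hrel ▸ zero_mem _)).1
  rw [← add_sub_cancel (α * t) w]
  exact Submodule.add_mem_sup (Ideal.mem_span_singleton.2 (dvd_mul_right α t)) hmem

theorem sq_le_span_pow_mul {ι : Type*} [Fintype ι] {w : ι → R} (hw : IsCotangentBasis I w)
    (hmI : maximalIdeal R * I = Ideal.span {α} * I) {k : ℕ} (hk : ∀ i < k, α ^ i ∉ I) :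
    I ^ 2 ≤ Ideal.span {α ^ k} * I := by
  induction k with
  | zero => simpa [Ideal.span_singleton_one] using Ideal.pow_le_self two_ne_zero
  | succ k ih =>
    intro y hy
    obtain ⟨v, hv, rfl⟩ :=
      Ideal.mem_span_singleton_mul.1 (ih (fun i hi => hk i (hi.trans k.lt_succ_self)) hy)
    obtain ⟨r, rfl⟩ := hw.exists_eq_sum hv
    simp only [Finset.mul_sum, ← mul_assoc] at hy
    have hr (j) : r j ∈ maximalIdeal R := fun hu =>
      hk k k.lt_succ_self ((Ideal.mul_unit_mem_iff_mem I hu).1 (hw.mem_of_sum_mem_sq _ hy j))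
    have hv' : ∑ j, r j * w j ∈ Ideal.span {α} * I :=
      hmI ▸ Ideal.sum_mem _ fun j _ => Ideal.mul_mem_mul (hr j) (hw.mem j)
    rw [pow_succ, ← Ideal.span_singleton_mul_span_singleton, mul_assoc]
    exact Ideal.mul_mem_mul (Ideal.mem_span_singleton_self _) hv'

end IsCotangentBasis

/-- The shape of an Ulrich ideal `I` in a ring with `𝔪 ^ 2 = α 𝔪`: the powers of `α` cut out the
ideals between `I` and `𝔪`, and the first power of `α` lying in `I` generates a reduction of `I`. -/
structure HasPowerReduction (α : R) (ℓ : ℕ) (I : Ideal R) : Prop where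
  maximalIdeal_eq : maximalIdeal R = Ideal.span {α} ⊔ I
  pow_mem_iff : ∀ i, α ^ i ∈ I ↔ ℓ ≤ i
  sq_eq : I ^ 2 = Ideal.span {α ^ ℓ} * I

theorem IsCotangentBasis.exists_hasPowerReduction
    (hw : IsCotangentBasis I (Fin.cons a x : Fin (n + 1) → R)) (hn : n ≠ 0)
    (hI : I.radical = maximalIdeal R) (hα : α ∈ maximalIdeal R) (hα0 : α ∈ R⁰)
    (hα2 : maximalIdeal R ^ 2 = Ideal.span {α} * maximalIdeal R) (ha0 : a ∈ R⁰)
    (hsq : I ^ 2 = Ideal.span {a} * I) : ∃ ℓ, HasPowerReduction α ℓ I := by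
  classical
  have hIm : I ≤ maximalIdeal R := hI ▸ Ideal.le_radical
  have hpow : ∃ i, α ^ i ∈ I := by rwa [← hI] at hα
  have hmI := hw.maximalIdeal_mul_eq hn hIm hα hα0 hα2 ha0 hsq
  refine ⟨Nat.find hpow, hw.maximalIdeal_eq_sup hn hIm hα hα0 hα2, fun i =>
    ⟨fun hi => Nat.find_min' hpow hi, fun hi => I.pow_mem_of_pow_mem (Nat.find_spec hpow) hi⟩,
    le_antisymm (hw.sq_le_span_pow_mul hmI fun i hi => Nat.find_min hpow hi) ?_⟩
  rw [sq]
  exact Ideal.mul_mono_left ((Ideal.span_singleton_le_iff_mem _).2 (Nat.find_spec hpow))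

end PowerReduction

section ChainIdeal

variable {R : Type*} [CommRing R] {α : R} {I : Ideal R} {i j ℓ : ℕ}

/-- The ideal `(α ^ i) + I`; the `i`-th term of the series connecting `I` and `𝔪`, with the
convention that the term of index `0` is `R`. -/
def chainIdeal (α : R) (I : Ideal R) (i : ℕ) : Ideal R := Ideal.span {α ^ i} ⊔ I

theorem mem_chainIdeal {y : R} : y ∈ chainIdeal α I i ↔ ∃ t, ∃ z ∈ I, t * α ^ i + z = y := by
  simp only [chainIdeal, Submodule.mem_sup, Ideal.mem_span_singleton', exists_exists_eq_and]

theorem pow_mem_chainIdeal : α ^ i ∈ chainIdeal α I i :=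
  Ideal.mem_sup_left (Ideal.mem_span_singleton_self _)

theorem le_chainIdeal : I ≤ chainIdeal α I i := le_sup_right

theorem chainIdeal_le_iff {J : Ideal R} (hIJ : I ≤ J) : chainIdeal α I i ≤ J ↔ α ^ i ∈ J := by
  rw [chainIdeal, sup_le_iff, Ideal.span_singleton_le_iff_mem, and_iff_left hIJ]

theorem chainIdeal_anti : Antitone (chainIdeal α I) := fun _ _ hij =>
  (chainIdeal_le_iff le_chainIdeal).2 (Ideal.pow_mem_of_pow_mem _ pow_mem_chainIdeal hij)

theorem chainIdeal_zero : chainIdeal α I 0 = ⊤ := by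
  rw [chainIdeal, pow_zero, Ideal.span_singleton_one, top_sup_eq]

theorem span_mul_chainIdeal_le : Ideal.span {α} * chainIdeal α I i ≤ chainIdeal α I (i + 1) := by
  rw [chainIdeal, Ideal.mul_sup, Ideal.span_singleton_mul_span_singleton, ← pow_succ']
  exact sup_le_sup_left Ideal.mul_le_right _

theorem chainIdeal_eq_span_insert {s : Set R} (hI : I = Ideal.span (insert (α ^ ℓ) s))
    (hi : i ≤ ℓ) : chainIdeal α I i = Ideal.span (insert (α ^ i) s) := by
  have hle : Ideal.span {α ^ ℓ} ≤ Ideal.span {α ^ i} :=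
    Ideal.span_singleton_le_span_singleton.2 (pow_dvd_pow α hi)
  rw [chainIdeal, hI, Ideal.span_insert, Ideal.span_insert, ← sup_assoc, sup_eq_left.2 hle]

variable [IsLocalRing R]

theorem isParameterIdeal_span_pow (hdim : ringKrullDim R = 1) (hα : α ∈ maximalIdeal R)
    (hα2 : maximalIdeal R ^ 2 = Ideal.span {α} * maximalIdeal R) (hi : 1 ≤ i) :
    IsParameterIdeal (Ideal.span {α ^ i}) := by
  refine ⟨le_antisymm ?_ fun x hx => ?_, 1, fun _ => α ^ i, by simpa using hdim, by simp⟩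
  · rw [(maximalIdeal.isMaximal R).isPrime.radical_le_iff, Ideal.span_singleton_le_iff_mem]
    exact Ideal.pow_mem_of_mem _ hα _ hi
  · have hx2 : x ^ 2 ∈ Ideal.span {α} := Ideal.mul_le_left (hα2 ▸ Ideal.pow_mem_pow hx 2)
    refine ⟨2 * i, ?_⟩
    rw [pow_mul, Ideal.mem_span_singleton]
    exact pow_dvd_pow_of_dvd (Ideal.mem_span_singleton.1 hx2) i

namespace HasPowerReduction

theorem mem_maximalIdeal (h : HasPowerReduction α ℓ I) : α ∈ maximalIdeal R :=
  h.maximalIdeal_eq ▸ Ideal.mem_sup_left (Ideal.mem_span_singleton_self α)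

theorem le_maximalIdeal (h : HasPowerReduction α ℓ I) : I ≤ maximalIdeal R :=
  h.maximalIdeal_eq ▸ le_sup_right

protected theorem pow_mem (h : HasPowerReduction α ℓ I) : α ^ ℓ ∈ I := (h.pow_mem_iff ℓ).2 le_rfl

theorem one_le (h : HasPowerReduction α ℓ I) : 1 ≤ ℓ := by
  by_contra! hℓ
  have h1 : α ^ 0 ∈ maximalIdeal R := h.le_maximalIdeal ((h.pow_mem_iff 0).2 (by lia))
  exact (Ideal.ne_top_iff_one _).1 Ideal.IsPrime.ne_top' (pow_zero α ▸ h1)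

theorem chainIdeal_one (h : HasPowerReduction α ℓ I) : chainIdeal α I 1 = maximalIdeal R := by
  rw [chainIdeal, pow_one, h.maximalIdeal_eq]

theorem chainIdeal_self (h : HasPowerReduction α ℓ I) : chainIdeal α I ℓ = I :=
  sup_eq_right.2 ((Ideal.span_singleton_le_iff_mem _).2 h.pow_mem)

theorem pow_mem_chainIdeal_iff (h : HasPowerReduction α ℓ I) (hi : i ≤ ℓ) :
    α ^ j ∈ chainIdeal α I i ↔ i ≤ j := by
  refine ⟨fun hj => ?_, fun hij => Ideal.pow_mem_of_pow_mem _ pow_mem_chainIdeal hij⟩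
  by_contra! hji
  obtain ⟨t, z, hz, htz⟩ := mem_chainIdeal.1 hj
  have hm : t * α ^ (i - j) ∈ maximalIdeal R := Ideal.mul_mem_left _ t
    (Ideal.pow_mem_of_mem _ h.mem_maximalIdeal _ (Nat.sub_pos_of_lt hji))
  have hu : IsUnit (1 - t * α ^ (i - j)) := isUnit_one_sub_self_of_mem_nonunits _ hm
  have hmem : α ^ j * (1 - t * α ^ (i - j)) ∈ I := by
    convert hz using 1
    rw [mul_sub, mul_one, mul_left_comm, ← pow_add, Nat.add_sub_cancel' hji.le]
    linear_combination -htz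
  rw [Ideal.mul_unit_mem_iff_mem I hu, h.pow_mem_iff] at hmem
  lia

theorem mul_pow_mem_chainIdeal (h : HasPowerReduction α ℓ I) {t : R} (ht : t ∈ maximalIdeal R) :
    t * α ^ i ∈ chainIdeal α I (i + 1) := by
  rw [h.maximalIdeal_eq, Submodule.mem_sup] at ht
  obtain ⟨u, hu, z, hz, rfl⟩ := ht
  rw [add_mul]
  exact add_mem (span_mul_chainIdeal_le (Ideal.mul_mem_mul hu pow_mem_chainIdeal))
    (le_chainIdeal (Ideal.mul_mem_right _ _ hz))

theorem exists_eq_chainIdeal (h : HasPowerReduction α ℓ I) {J : Ideal R} (hIJ : I ≤ J) :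
    ∃ k ≤ ℓ, J = chainIdeal α I k := by
  classical
  have hpow : ∃ k, α ^ k ∈ J := ⟨ℓ, hIJ h.pow_mem⟩
  refine ⟨Nat.find hpow, Nat.find_min' hpow (hIJ h.pow_mem),
    le_antisymm ?_ ((chainIdeal_le_iff hIJ).2 (Nat.find_spec hpow))⟩
  suffices hle : ∀ k ≤ Nat.find hpow, J ≤ chainIdeal α I k from hle _ le_rfl
  intro k hk
  induction k with
  | zero => exact le_top.trans_eq chainIdeal_zero.symm
  | succ k ih =>
    intro y hy
    obtain ⟨t, z, hz, rfl⟩ := mem_chainIdeal.1 (ih (Nat.le_of_succ_le hk) hy)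
    have htJ : t * α ^ k ∈ J := (Submodule.add_mem_iff_left _ (hIJ hz)).1 hy
    have ht : t ∈ maximalIdeal R := fun hu =>
      Nat.find_min hpow hk ((Ideal.unit_mul_mem_iff_mem J hu).1 htJ)
    exact add_mem (h.mul_pow_mem_chainIdeal ht) (le_chainIdeal hz)

theorem exists_eq_chainIdeal_of_le (h : HasPowerReduction α ℓ I) {J : Ideal R} (hIJ : I ≤ J)
    (hJ : J ≤ maximalIdeal R) : ∃ k, 1 ≤ k ∧ k ≤ ℓ ∧ J = chainIdeal α I k := by
  obtain ⟨k, hk, rfl⟩ := h.exists_eq_chainIdeal hIJ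
  refine ⟨k, (h.pow_mem_chainIdeal_iff h.one_le).1 ?_, hk, rfl⟩
  exact h.chainIdeal_one ▸ hJ pow_mem_chainIdeal

theorem isCompSeries (h : HasPowerReduction α ℓ I) : IsCompSeries I ℓ (chainIdeal α I) where
  one_le := h.one_le
  first := h.chainIdeal_one
  last := h.chainIdeal_self
  covBy i _ hi := by
    refine ⟨lt_of_le_of_ne (chainIdeal_anti i.le_succ) fun heq => ?_, fun J hJ hJi => ?_⟩
    · have hpow : α ^ i ∈ chainIdeal α I (i + 1) := heq ▸ pow_mem_chainIdeal
      exact i.not_succ_le_self ((h.pow_mem_chainIdeal_iff hi).1 hpow)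
    · obtain ⟨k, -, rfl⟩ := h.exists_eq_chainIdeal (le_chainIdeal.trans hJ.le)
      have hki := chainIdeal_anti.reflect_lt hJ
      have hik := chainIdeal_anti.reflect_lt hJi
      lia

theorem exists_eq_of_isCompSeries (h : HasPowerReduction α ℓ I) {m : ℕ} {c : ℕ → Ideal R}
    (hc : IsCompSeries I m c) {J : Ideal R} (hIJ : I ≤ J) (hJ : J ≤ maximalIdeal R) :
    ∃ k, 1 ≤ k ∧ k ≤ m ∧ J = c k := by
  obtain ⟨rfl, hcd⟩ := h.isCompSeries.unique (fun _ => h.exists_eq_chainIdeal_of_le) hc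
  obtain ⟨k, hk1, hk, rfl⟩ := h.exists_eq_chainIdeal_of_le hIJ hJ
  exact ⟨k, hk1, hk, (hcd k hk1 hk).symm⟩

theorem mem_chainIdeal_of_pow_mul_mem (h : HasPowerReduction α ℓ I) (hi : i ≤ ℓ) {s : R}
    (hs : α ^ (ℓ - i) * s ∈ I) : s ∈ chainIdeal α I i := by
  obtain ⟨k, -, hJ⟩ := h.exists_eq_chainIdeal (J := Ideal.span {s} ⊔ I) le_sup_right
  obtain ⟨u, hu, z, hz, huz⟩ := Submodule.mem_sup.1 (hJ ▸ pow_mem_chainIdeal : α ^ k ∈ _)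
  obtain ⟨t, rfl⟩ := Ideal.mem_span_singleton'.1 hu
  have hpow : α ^ (ℓ - i + k) ∈ I := by
    rw [pow_add, ← huz, mul_add, mul_left_comm]
    exact add_mem (Ideal.mul_mem_left _ _ hs) (Ideal.mul_mem_left _ _ hz)
  have hik : i ≤ k := by have := (h.pow_mem_iff _).1 hpow; lia
  exact chainIdeal_anti hik (hJ ▸ Ideal.mem_sup_left (Ideal.mem_span_singleton_self s))

theorem chainIdeal_mul_chainIdeal (h : HasPowerReduction α ℓ I) (hij : i ≤ j) (hj : j ≤ ℓ) :
    chainIdeal α I i * chainIdeal α I j = Ideal.span {α ^ i} * chainIdeal α I j := by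
  have hpow {k : ℕ} (hk : i ≤ k) : Ideal.span {α ^ k} * I ≤ Ideal.span {α ^ i} * I :=
    Ideal.mul_mono_left (Ideal.span_singleton_le_span_singleton.2 (pow_dvd_pow α hk))
  refine le_antisymm ?_ (Ideal.mul_mono_left le_sup_left)
  rw [chainIdeal, Ideal.sup_mul]
  refine sup_le le_rfl (le_trans ?_ (Ideal.mul_mono_right le_chainIdeal))
  rw [chainIdeal, Ideal.mul_sup, mul_comm I, ← sq, h.sq_eq]
  exact sup_le (hpow hij) (hpow (hij.trans hj))

theorem chainIdeal_sq (h : HasPowerReduction α ℓ I) (hi : i ≤ ℓ) :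
    chainIdeal α I i ^ 2 = Ideal.span {α ^ i} * chainIdeal α I i := by
  rw [sq, h.chainIdeal_mul_chainIdeal le_rfl hi]

theorem maximalIdeal_sq (h : HasPowerReduction α ℓ I) :
    maximalIdeal R ^ 2 = Ideal.span {α} * maximalIdeal R := by
  rw [← h.chainIdeal_one, h.chainIdeal_sq h.one_le, pow_one]

theorem isReduction_chainIdeal (h : HasPowerReduction α ℓ I) (hi : i ≤ ℓ) :
    IsReduction (Ideal.span {α ^ i}) (chainIdeal α I i) :=
  ⟨le_sup_left, 1, by rw [pow_one, h.chainIdeal_sq hi]⟩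

variable {n : ℕ} {x : Fin n → R}

theorem isCotangentBasis_chainIdeal (h : HasPowerReduction α ℓ I)
    (hw : IsCotangentBasis I (Fin.cons (α ^ ℓ) x : Fin (n + 1) → R)) (hi : i ≤ ℓ) :
    IsCotangentBasis (chainIdeal α I i) (Fin.cons (α ^ i) x : Fin (n + 1) → R) := by
  obtain ⟨hspan, hrel⟩ := IsCotangentBasis.cons_iff.1 hw
  refine IsCotangentBasis.cons_iff.2
    ⟨(chainIdeal_eq_span_insert hspan.symm hi).symm, fun t s hts => ?_⟩
  rw [h.chainIdeal_sq hi, Ideal.mem_span_singleton_mul] at hts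
  obtain ⟨_, hy, hyts⟩ := hts
  obtain ⟨u, z, hz, rfl⟩ := mem_chainIdeal.1 hy
  have hpow : α ^ ℓ = α ^ (ℓ - i) * α ^ i := (pow_sub_mul_pow α hi).symm
  have hmul : (t - u * α ^ i) * α ^ ℓ + ∑ j, α ^ (ℓ - i) * s j * x j = α ^ ℓ * z := by
    simp only [mul_assoc (α ^ (ℓ - i)), ← Finset.mul_sum, hpow]
    linear_combination -α ^ (ℓ - i) * hyts
  obtain ⟨ht, hs⟩ := hrel _ _ (hmul ▸ h.sq_eq ▸ Ideal.mul_mem_mul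
    (Ideal.mem_span_singleton_self _) hz)
  refine ⟨?_, fun j => h.mem_chainIdeal_of_pow_mul_mem hi (hs j)⟩
  rw [← sub_add_cancel t (u * α ^ i)]
  exact add_mem (le_chainIdeal ht) (Ideal.mul_mem_left _ _ pow_mem_chainIdeal)

theorem embDim_eq [IsNoetherianRing R] (h : HasPowerReduction α ℓ I)
    (hw : IsCotangentBasis I (Fin.cons (α ^ ℓ) x : Fin (n + 1) → R)) : embDim R = n + 1 := by
  have hw1 := h.isCotangentBasis_chainIdeal hw h.one_le
  rw [h.chainIdeal_one] at hw1
  rw [hw1.embDim_eq_card, Fintype.card_fin]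

theorem isUlrich_chainIdeal (h : HasPowerReduction α ℓ I)
    (hw : IsCotangentBasis I (Fin.cons (α ^ ℓ) x : Fin (n + 1) → R)) (hn : n ≠ 0)
    (hdim : ringKrullDim R = 1) (hi1 : 1 ≤ i) (hi : i ≤ ℓ) : IsUlrich (chainIdeal α I i) := by
  have hpar := isParameterIdeal_span_pow hdim h.mem_maximalIdeal h.maximalIdeal_sq hi1
  have hle : chainIdeal α I i ≤ maximalIdeal R := h.chainIdeal_one ▸ chainIdeal_anti hi1
  have hwi := h.isCotangentBasis_chainIdeal hw hi
  have hne : chainIdeal α I i ≠ Ideal.span {α ^ i} :=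
    (hwi.eq_span_singleton_iff (ne_top_of_le_ne_top Ideal.IsPrime.ne_top' hle)).not.2 hn
  refine ⟨le_antisymm ?_ (hpar.1.symm.le.trans (Ideal.radical_mono le_sup_left)),
    ⟨_, hpar, h.isReduction_chainIdeal hi, hne, h.chainIdeal_sq hi⟩, hwi.free⟩
  exact (maximalIdeal.isMaximal R).isPrime.radical_le_iff.2 hle

end HasPowerReduction

end ChainIdeal

section FiniteExtension

variable {R S : Type*} [CommRing R] [IsLocalRing R] [CommRing S] [Algebra R S]

theorem isMaximal_of_exists_sub_algebraMap_mem {n : Ideal S} (hn : n ≠ ⊤)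
    (hsurj : ∀ s : S, ∃ r : R, s - algebraMap R S r ∈ n)
    (hm : ∀ r ∈ maximalIdeal R, algebraMap R S r ∈ n) : n.IsMaximal := by
  refine ⟨hn, fun J hJ => ?_⟩
  obtain ⟨s, hsJ, hsn⟩ := SetLike.exists_of_lt hJ
  obtain ⟨r, hr⟩ := hsurj s
  have hru : IsUnit r := by
    by_contra hru
    exact hsn ((Submodule.sub_mem_iff_left _ (hm r hru)).1 hr)
  refine J.eq_top_of_isUnit_mem ?_ (hru.map (algebraMap R S))
  exact (Submodule.sub_mem_iff_right _ hsJ).1 (hJ.le hr)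

theorem algebraMap_mem_of_isMaximal [Algebra.IsIntegral R S] {r : R} (hr : r ∈ maximalIdeal R)
    (M : Ideal S) [M.IsMaximal] : algebraMap R S r ∈ M := by
  rw [← Ideal.mem_comap, eq_maximalIdeal (M.isMaximal_comap_of_isIntegral_of_isMaximal (R := R))]
  exact hr

theorem isLocalRing_of_sq_le [Algebra.IsIntegral R S] {r : R} (hr : r ∈ maximalIdeal R)
    {n : Ideal S} (hn : n.IsMaximal) (hsq : n ^ 2 ≤ Ideal.span {algebraMap R S r}) :
    IsLocalRing S := by
  refine .of_unique_max_ideal ⟨n, hn, fun M hM => (hn.eq_of_le hM.ne_top ?_).symm⟩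
  refine hM.isPrime.le_of_pow_le (hsq.trans ?_)
  exact (Ideal.span_singleton_le_iff_mem M).2 (algebraMap_mem_of_isMaximal hr M)

end FiniteExtension

section SelfColon

variable {R : Type*} [CommRing R] {K : Type*} [CommRing K] [Algebra R K]

theorem selfColon_eq_of_mem_iff {t : K} (ht : IsUnit t) {M N : Submodule R K}
    (hN : ∀ y, y ∈ N ↔ t * y ∈ M) : selfColon N = selfColon M := by
  ext y
  refine ⟨fun hy z hz => ?_, fun hy z hz => ?_⟩
  · obtain ⟨w, rfl⟩ := ht.dvd (a := z)
    rw [mul_left_comm, ← hN]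
    exact hy w ((hN w).2 hz)
  · rw [hN, mul_left_comm]
    exact hy _ ((hN z).1 hz)

theorem overring_congr {c d : ℕ → Ideal R} {ℓ i : ℕ} (hcd : ∀ i, 1 ≤ i → i ≤ ℓ → c i = d i)
    (hi : i ≤ ℓ) : overring K c i = overring K d i := by
  cases i with
  | zero => rfl
  | succ i => rw [overring, overring, hcd _ i.succ_pos hi]

theorem overring_eq_selfColon {c : ℕ → Ideal R} (hc : c 0 = ⊤) :
    ∀ i, overring K c i = selfColon (IsLocalization.coeSubmodule K (c i))
  | 0 => by
    rw [overring, hc, IsLocalization.coeSubmodule_top, eq_comm, eq_bot_iff]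
    intro y hy
    simpa [Algebra.mem_bot, Submodule.mem_one] using hy 1 (Submodule.one_le.1 le_rfl)
  | _ + 1 => rfl

theorem le_integralClosure_of_finite (B : Subalgebra R K) [Module.Finite R B] :
    B ≤ integralClosure R K := fun x hx =>
  (Algebra.IsIntegral.isIntegral (R := R) (⟨x, hx⟩ : B)).map B.val

variable [IsFractionRing R K] {J : Ideal R} {a r : R}

theorem isUnit_algebraMap (ha : a ∈ R⁰) : IsUnit (algebraMap R K a) :=
  IsLocalization.map_units K (⟨a, ha⟩ : R⁰)

theorem algebraMap_mem_nonZeroDivisors (ha : a ∈ R⁰) (B : Subalgebra R K) :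
    algebraMap R B a ∈ B⁰ :=
  mem_nonZeroDivisors_iff_left.2 fun _ hy => Subtype.ext
    ((isUnit_algebraMap ha).mul_right_eq_zero.1 (congrArg Subtype.val hy))

theorem algebraMap_mem_coeSubmodule :
    algebraMap R K r ∈ IsLocalization.coeSubmodule K J ↔ r ∈ J := by
  rw [IsLocalization.mem_coeSubmodule]
  exact ⟨fun ⟨s, hs, hsr⟩ => IsFractionRing.injective R K hsr ▸ hs, fun hr => ⟨r, hr, rfl⟩⟩

theorem mem_selfColon_coeSubmodule_iff (haJ : a ∈ J) (ha : a ∈ R⁰)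
    (hsq : J ^ 2 = Ideal.span {a} * J) {y : K} :
    y ∈ selfColon (IsLocalization.coeSubmodule K J) ↔
      algebraMap R K a * y ∈ IsLocalization.coeSubmodule K J := by
  refine ⟨fun hy => mul_comm y _ ▸ hy _ (algebraMap_mem_coeSubmodule.2 haJ), ?_⟩
  rintro ⟨z, hz, hzy⟩ _ ⟨s, hs, rfl⟩
  obtain ⟨u, hu, huzs⟩ : ∃ u ∈ J, a * u = z * s := by
    rw [← Ideal.mem_span_singleton_mul, ← hsq, sq]
    exact Ideal.mul_mem_mul hz hs
  refine ⟨u, hu, (isUnit_algebraMap (K := K) ha).mul_left_cancel ?_⟩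
  simp only [Algebra.linearMap_apply] at hzy ⊢
  rw [← map_mul, huzs, map_mul, hzy, mul_assoc]

theorem finite_selfColon_coeSubmodule [IsNoetherianRing R] (haJ : a ∈ J) (ha : a ∈ R⁰) :
    Module.Finite R (selfColon (IsLocalization.coeSubmodule K J)) := by
  have : Module.Finite R (IsLocalization.coeSubmodule K J) := Module.Finite.map J _
  let f := (LinearMap.mulRight R (algebraMap R K a) ∘ₗ (Subalgebra.val _).toLinearMap).codRestrict
    (IsLocalization.coeSubmodule K J)
    fun y : selfColon _ => y.2 _ (algebraMap_mem_coeSubmodule.2 haJ)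
  refine Module.Finite.of_injective f fun y z hyz => Subtype.ext ?_
  exact (isUnit_algebraMap ha).mul_right_cancel (congrArg Subtype.val hyz)

theorem finite_overring_chainIdeal [IsNoetherianRing R] {I : Ideal R} (ha : a ∈ R⁰) (i : ℕ) :
    Module.Finite R (overring K (chainIdeal a I) i) := by
  rw [overring_eq_selfColon chainIdeal_zero]
  exact finite_selfColon_coeSubmodule pow_mem_chainIdeal (pow_mem ha i)

end SelfColon

namespace HasPowerReduction

section Tower

variable {R : Type*} [CommRing R] [IsLocalRing R] {α : R} {I : Ideal R} {i j ℓ n : ℕ}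
  {x : Fin n → R} {K : Type*} [CommRing K] [Algebra R K] [IsFractionRing R K]

theorem mem_overring_iff (h : HasPowerReduction α ℓ I) (hα0 : α ∈ R⁰) (hi : i ≤ ℓ) {y : K} :
    y ∈ overring K (chainIdeal α I) i ↔
      algebraMap R K (α ^ i) * y ∈ IsLocalization.coeSubmodule K (chainIdeal α I i) := by
  rw [overring_eq_selfColon chainIdeal_zero,
    mem_selfColon_coeSubmodule_iff pow_mem_chainIdeal (pow_mem hα0 i) (h.chainIdeal_sq hi)]

theorem exists_mem_overring (h : HasPowerReduction α ℓ I) (hα0 : α ∈ R⁰) (hi : i ≤ ℓ) {z : R}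
    (hz : z ∈ chainIdeal α I i) :
    ∃ y ∈ overring K (chainIdeal α I) i, algebraMap R K (α ^ i) * y = algebraMap R K z := by
  obtain ⟨y, hy⟩ := (isUnit_algebraMap (K := K) (pow_mem hα0 i)).dvd (a := algebraMap R K z)
  exact ⟨y, (h.mem_overring_iff hα0 hi).2 (hy ▸ algebraMap_mem_coeSubmodule.2 hz), hy.symm⟩

theorem overring_le_selfColon (h : HasPowerReduction α ℓ I) (hα0 : α ∈ R⁰) (hij : i ≤ j)
    (hj : j ≤ ℓ) : overring K (chainIdeal α I) i ≤
      selfColon (IsLocalization.coeSubmodule K (chainIdeal α I j)) := by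
  rintro y hy _ ⟨s, hs, rfl⟩
  obtain ⟨z, hz, hzy⟩ := (h.mem_overring_iff hα0 (hij.trans hj)).1 hy
  obtain ⟨u, hu, huzs⟩ : ∃ u ∈ chainIdeal α I j, α ^ i * u = z * s := by
    rw [← Ideal.mem_span_singleton_mul, ← h.chainIdeal_mul_chainIdeal hij hj]
    exact Ideal.mul_mem_mul hz hs
  refine ⟨u, hu, (isUnit_algebraMap (K := K) (pow_mem hα0 i)).mul_left_cancel ?_⟩
  simp only [Algebra.linearMap_apply] at hzy ⊢
  rw [← map_mul, huzs, map_mul, hzy, mul_assoc]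

theorem overring_lt (h : HasPowerReduction α ℓ I) (hα0 : α ∈ R⁰)
    (hw : IsCotangentBasis I (Fin.cons (α ^ ℓ) x : Fin (n + 1) → R)) (hn : n ≠ 0) (hi : i < ℓ) :
    overring K (chainIdeal α I) i < overring K (chainIdeal α I) (i + 1) := by
  refine lt_of_le_of_ne (h.overring_le_selfColon hα0 i.le_succ hi) fun heq => hn ?_
  have hw1 := h.isCotangentBasis_chainIdeal hw h.one_le
  rw [← hw1.eq_span_singleton_iff (h.chainIdeal_one ▸ Ideal.IsPrime.ne_top'), chainIdeal, pow_one,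
    sup_eq_left]
  -- Were `B_i = B_{i + 1}`, then `I_{i + 1} = α I_i ⊆ (α)` and `𝔪` would be principal.
  intro z hz
  obtain ⟨y, hy, hyz⟩ := h.exists_mem_overring (K := K) hα0 hi (le_chainIdeal hz)
  obtain ⟨s, -, hsy⟩ := (h.mem_overring_iff hα0 hi.le).1 (heq ▸ hy)
  refine Ideal.mem_span_singleton.2 ⟨s, IsFractionRing.injective R K ?_⟩
  rw [← hyz, pow_succ', map_mul, mul_assoc, ← hsy, Algebra.linearMap_apply, map_mul]

variable (K) in
/-- The ideal `α ^ (-i) I_{i + 1}` of `B_i = α ^ (-i) I_i`; it is the maximal ideal. -/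
def overringIdeal (h : HasPowerReduction α ℓ I) (hα0 : α ∈ R⁰) (hi : i < ℓ) :
    Ideal (overring K (chainIdeal α I) i) where
  carrier := {y | algebraMap R K (α ^ i) * y ∈
    IsLocalization.coeSubmodule K (chainIdeal α I (i + 1))}
  zero_mem' := by
    simp only [Set.mem_ofPred_eq, ZeroMemClass.coe_zero, mul_zero, zero_mem]
  add_mem' {y z} hy hz := by
    simpa only [Set.mem_ofPred_eq, AddMemClass.coe_add, mul_add] using add_mem hy hz
  smul_mem' b y hy := by
    simpa only [Set.mem_ofPred_eq, smul_eq_mul, MulMemClass.coe_mul, mul_left_comm] using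
      h.overring_le_selfColon hα0 i.le_succ hi b.2 _ hy

theorem mem_overringIdeal (h : HasPowerReduction α ℓ I) (hα0 : α ∈ R⁰) (hi : i < ℓ)
    {y : overring K (chainIdeal α I) i} : y ∈ h.overringIdeal K hα0 hi ↔
      algebraMap R K (α ^ i) * y ∈ IsLocalization.coeSubmodule K (chainIdeal α I (i + 1)) :=
  Iff.rfl

theorem algebraMap_mem_overringIdeal (h : HasPowerReduction α ℓ I) (hα0 : α ∈ R⁰) (hi : i < ℓ)
    {r : R} (hr : r ∈ maximalIdeal R) : algebraMap R _ r ∈ h.overringIdeal K hα0 hi := by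
  rw [mem_overringIdeal, mul_comm, Subalgebra.coe_algebraMap, ← map_mul,
    algebraMap_mem_coeSubmodule]
  exact h.mul_pow_mem_chainIdeal hr

theorem exists_sub_algebraMap_mem_overringIdeal (h : HasPowerReduction α ℓ I) (hα0 : α ∈ R⁰)
    (hi : i < ℓ) (y : overring K (chainIdeal α I) i) :
    ∃ r : R, y - algebraMap R _ r ∈ h.overringIdeal K hα0 hi := by
  obtain ⟨s, hs, hsy⟩ := (h.mem_overring_iff hα0 hi.le).1 y.2
  obtain ⟨r, z, hz, rfl⟩ := mem_chainIdeal.1 hs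
  refine ⟨r, z, le_chainIdeal hz, ?_⟩
  simp only [Algebra.linearMap_apply, map_add, map_mul] at hsy
  rw [AddSubgroupClass.coe_sub, Subalgebra.coe_algebraMap, mul_sub, ← hsy,
    Algebra.linearMap_apply]
  ring

theorem isMaximal_overringIdeal (h : HasPowerReduction α ℓ I) (hα0 : α ∈ R⁰) (hi : i < ℓ) :
    (h.overringIdeal K hα0 hi).IsMaximal := by
  refine isMaximal_of_exists_sub_algebraMap_mem (R := R) ?_
    (h.exists_sub_algebraMap_mem_overringIdeal hα0 hi)
    fun r hr => h.algebraMap_mem_overringIdeal hα0 hi hr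
  rw [Ideal.ne_top_iff_one, mem_overringIdeal, OneMemClass.coe_one, mul_one,
    algebraMap_mem_coeSubmodule, h.pow_mem_chainIdeal_iff hi]
  exact i.not_succ_le_self

theorem overringIdeal_sq (h : HasPowerReduction α ℓ I) (hα0 : α ∈ R⁰) (hi : i < ℓ) :
    h.overringIdeal K hα0 hi ^ 2 =
      Ideal.span {algebraMap R _ α} * h.overringIdeal K hα0 hi := by
  rw [sq]
  have hα := h.algebraMap_mem_overringIdeal (K := K) hα0 hi h.mem_maximalIdeal
  refine le_antisymm (Ideal.mul_le.2 fun y hy z hz => ?_)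
    (Ideal.mul_mono_left ((Ideal.span_singleton_le_iff_mem _).2 hα))
  obtain ⟨s, hs, hsy⟩ := hy
  obtain ⟨t, ht, htz⟩ := hz
  obtain ⟨u, hu, hust⟩ : ∃ u ∈ chainIdeal α I (i + 1), α ^ (i + 1) * u = s * t := by
    rw [← Ideal.mem_span_singleton_mul, ← h.chainIdeal_sq hi, sq]
    exact Ideal.mul_mem_mul hs ht
  obtain ⟨v, hv, hvu⟩ := h.exists_mem_overring (K := K) hα0 hi.le (chainIdeal_anti i.le_succ hu)
  refine Ideal.mem_span_singleton_mul.2 ⟨⟨v, hv⟩, ⟨u, hu, hvu.symm⟩, Subtype.ext ?_⟩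
  refine (isUnit_algebraMap (K := K) (pow_mem (pow_mem hα0 i) 2)).mul_left_cancel ?_
  have hust' := congrArg (algebraMap R K) hust
  simp only [Algebra.linearMap_apply, map_mul, map_pow] at hsy htz hvu hust' ⊢
  rw [MulMemClass.coe_mul, MulMemClass.coe_mul, Subalgebra.coe_algebraMap]
  linear_combination algebraMap R K α ^ (i + 1) * hvu + hust' + algebraMap R K t * hsy +
    algebraMap R K α ^ i * y * htz

theorem isLocalRing_overring [IsNoetherianRing R] (h : HasPowerReduction α ℓ I) (hα0 : α ∈ R⁰)
    (hi : i < ℓ) : IsLocalRing (overring K (chainIdeal α I) i) := by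
  have := finite_overring_chainIdeal (K := K) (I := I) hα0 i
  exact isLocalRing_of_sq_le h.mem_maximalIdeal (h.isMaximal_overringIdeal hα0 hi)
    ((h.overringIdeal_sq hα0 hi).trans_le Ideal.mul_le_left)

theorem exists_isCotangentBasis_overringIdeal (h : HasPowerReduction α ℓ I) (hα0 : α ∈ R⁰)
    (hw : IsCotangentBasis I (Fin.cons (α ^ ℓ) x : Fin (n + 1) → R)) (hi : i < ℓ) :
    ∃ w : Fin (n + 1) → overring K (chainIdeal α I) i,
      IsCotangentBasis (h.overringIdeal K hα0 hi) w := by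
  have hwi := h.isCotangentBasis_chainIdeal hw hi
  set w' : Fin (n + 1) → R := Fin.cons (α ^ (i + 1)) x
  choose w hwB hww' using fun j =>
    h.exists_mem_overring (K := K) hα0 hi.le (chainIdeal_anti i.le_succ (hwi.mem j))
  let v (j : Fin (n + 1)) : overring K (chainIdeal α I) i := ⟨w j, hwB j⟩
  have hsum (r : Fin (n + 1) → R) :
      algebraMap R K (α ^ i) * (∑ j, algebraMap R _ (r j) * v j : overring K (chainIdeal α I) i) =
        algebraMap R K (∑ j, r j * w' j) := by
    simp only [AddSubmonoidClass.coe_finsetSum, MulMemClass.coe_mul, Subalgebra.coe_algebraMap,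
      Finset.mul_sum, map_sum, map_mul, ← hww', v, mul_left_comm]
  refine ⟨v, IsCotangentBasis.of_algebraMap (R := R) (le_antisymm ?_ fun y hy => ?_)
    (h.exists_sub_algebraMap_mem_overringIdeal hα0 hi) fun r hr j => ?_⟩
  · exact Ideal.span_le.2 (Set.range_subset_iff.2 fun j => ⟨w' j, hwi.mem j, (hww' j).symm⟩)
  · obtain ⟨z, hz, hzy⟩ := hy
    obtain ⟨r, rfl⟩ := hwi.exists_eq_sum hz
    refine Ideal.mem_span_range_iff_exists_fun.2 ⟨fun j => algebraMap R _ (r j), Subtype.ext ?_⟩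
    exact (isUnit_algebraMap (pow_mem hα0 i)).mul_left_cancel ((hsum r).trans hzy)
  · rw [overringIdeal_sq, Ideal.mem_span_singleton_mul] at hr
    obtain ⟨y, ⟨z, hz, hzy⟩, hyr⟩ := hr
    rw [Algebra.linearMap_apply] at hzy
    obtain ⟨t, rfl⟩ := hwi.exists_eq_sum hz
    have hrt : ∑ k, (r k - α * t k) * w' k = 0 := by
      apply IsFractionRing.injective R K
      simp only [sub_mul, Finset.sum_sub_distrib, mul_assoc, ← Finset.mul_sum]
      rw [map_sub, ← hsum, ← hyr, map_mul, hzy, map_zero, MulMemClass.coe_mul,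
        Subalgebra.coe_algebraMap]
      ring
    have hrj := hwi.mem_of_sum_mem_sq _ (hrt ▸ zero_mem _) j
    have hle : chainIdeal α I (i + 1) ≤ maximalIdeal R :=
      h.chainIdeal_one ▸ chainIdeal_anti i.succ_pos
    refine h.algebraMap_mem_overringIdeal hα0 hi ?_
    rw [← sub_add_cancel (r j) (α * t j)]
    exact add_mem (hle hrj) (Ideal.mul_mem_right _ _ h.mem_maximalIdeal)

theorem exists_isLocalRing_overring [IsNoetherianRing R] (h : HasPowerReduction α ℓ I)
    (hα0 : α ∈ R⁰) (hw : IsCotangentBasis I (Fin.cons (α ^ ℓ) x : Fin (n + 1) → R)) (hi : i < ℓ) :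
    ∃ _ : IsLocalRing (overring K (chainIdeal α I) i),
      jacobsonRadical (overring K (chainIdeal α I) i) = maximalIdeal _ ∧
      IsCohenMacaulayLocal (overring K (chainIdeal α I) i) ∧
      ringKrullDim (overring K (chainIdeal α I) i) = 1 ∧
      embDim (overring K (chainIdeal α I) i) = embDim R ∧
      HasMultiplicity (overring K (chainIdeal α I) i) (embDim R) ∧
      jacobsonRadical (overring K (chainIdeal α I) i) ^ 2 =
        Ideal.span {algebraMap R _ α} * jacobsonRadical (overring K (chainIdeal α I) i) := by
  have hloc := h.isLocalRing_overring (K := K) hα0 hi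
  have hfin := finite_overring_chainIdeal (K := K) (I := I) hα0 i
  have hnoeth : IsNoetherianRing (overring K (chainIdeal α I) i) := .of_finite R _
  have hmax := eq_maximalIdeal (h.isMaximal_overringIdeal (K := K) hα0 hi)
  have hjac : jacobsonRadical (overring K (chainIdeal α I) i) = maximalIdeal _ :=
    jacobson_eq_maximalIdeal ⊥ bot_ne_top
  have hα := h.algebraMap_mem_overringIdeal (K := K) hα0 hi h.mem_maximalIdeal
  have hsq := h.overringIdeal_sq (K := K) hα0 hi
  have hreg := algebraMap_mem_nonZeroDivisors hα0 (overring K (chainIdeal α I) i)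
  obtain ⟨w, hw'⟩ := h.exists_isCotangentBasis_overringIdeal (K := K) hα0 hw hi
  rw [hmax] at hα hsq hw'
  have hemb : embDim (overring K (chainIdeal α I) i) = embDim R := by
    rw [hw'.embDim_eq_card, Fintype.card_fin, h.embDim_eq hw]
  exact ⟨hloc, hjac, isCohenMacaulayLocal_of_sq_eq hα hreg hsq,
    ringKrullDim_eq_one_of_sq_eq hα hreg hsq, hemb, hemb ▸ hasMultiplicity_embDim hreg hsq,
    hjac ▸ hsq⟩

theorem selfColon_jacobsonSubmodule_overring [IsNoetherianRing R] (h : HasPowerReduction α ℓ I)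
    (hα0 : α ∈ R⁰) (hi : i < ℓ) :
    selfColon (jacobsonSubmodule (overring K (chainIdeal α I) i)) =
      overring K (chainIdeal α I) (i + 1) := by
  have hloc := h.isLocalRing_overring (K := K) hα0 hi
  have hjac : jacobsonRadical (overring K (chainIdeal α I) i) = h.overringIdeal K hα0 hi :=
    (jacobson_eq_maximalIdeal ⊥ bot_ne_top).trans
      (eq_maximalIdeal (h.isMaximal_overringIdeal hα0 hi)).symm
  refine selfColon_eq_of_mem_iff (isUnit_algebraMap (pow_mem hα0 i)) fun y => ?_
  rw [jacobsonSubmodule, hjac]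
  refine ⟨fun ⟨_, hv, hvy⟩ => hvy ▸ hv, fun hy => ?_⟩
  have hyB : y ∈ overring K (chainIdeal α I) i := (h.mem_overring_iff hα0 hi.le).2
    (IsLocalization.coeSubmodule_mono K (chainIdeal_anti i.le_succ) hy)
  exact ⟨⟨y, hyB⟩, hy, rfl⟩

end Tower

end HasPowerReduction

section Ulrich

variable {R : Type*} [CommRing R]

theorem mem_nonZeroDivisors_of_dvd_pow {a t : R} {k : ℕ} (ht : t ∈ R⁰) (h : a ∣ t ^ k) :
    a ∈ R⁰ := by
  obtain ⟨c, hc⟩ := h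
  exact (mul_mem_nonZeroDivisors.1 (hc ▸ pow_mem ht k)).1

variable [IsLocalRing R] {I : Ideal R}

theorem IsCohenMacaulayLocal.exists_mem_nonZeroDivisors (hCM : IsCohenMacaulayLocal R)
    (hdim : ringKrullDim R = 1) : ∃ t ∈ maximalIdeal R, t ∈ R⁰ := by
  obtain ⟨-, rs, hrs, hreg, hlen⟩ := hCM
  obtain ⟨t, rfl⟩ : ∃ t, rs = [t] :=
    List.length_eq_one_iff.1 (by rw [hdim] at hlen; exact_mod_cast hlen.symm)
  have hweak := (RingTheory.Sequence.isWeaklyRegular_singleton_iff R t).1 hreg.toIsWeaklyRegular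
  refine ⟨t, hrs t (List.mem_singleton_self t), mem_nonZeroDivisors_iff_left.2 fun x hx => ?_⟩
  exact hweak (by simpa using hx)

theorem IsParameterIdeal.exists_eq_span_singleton {Q : Ideal R} (hQ : IsParameterIdeal Q)
    (hdim : ringKrullDim R = 1) : ∃ a, Q = Ideal.span {a} := by
  obtain ⟨-, d, a, hd, rfl⟩ := hQ
  obtain rfl : d = 1 := by rw [hdim] at hd; exact_mod_cast hd.symm
  exact ⟨a 0, by rw [Set.range_unique, Fin.default_eq_zero]⟩

theorem IsUlrich.le_maximalIdeal (hI : IsUlrich I) : I ≤ maximalIdeal R :=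
  hI.radical_eq ▸ Ideal.le_radical

theorem IsUlrich.exists_sq_eq (hI : IsUlrich I) (hCM : IsCohenMacaulayLocal R)
    (hdim : ringKrullDim R = 1) :
    ∃ a ∈ I, a ∈ R⁰ ∧ I ≠ Ideal.span {a} ∧ I ^ 2 = Ideal.span {a} * I := by
  obtain ⟨Q, hQ, ⟨hQI, -⟩, hne, hsq⟩ := hI.exists_reduction
  obtain ⟨a, rfl⟩ := hQ.exists_eq_span_singleton hdim
  obtain ⟨t, htm, ht0⟩ := hCM.exists_mem_nonZeroDivisors hdim
  obtain ⟨k, hk⟩ := hQ.1 ▸ htm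
  exact ⟨a, hQI (Ideal.mem_span_singleton_self a),
    mem_nonZeroDivisors_of_dvd_pow ht0 (Ideal.mem_span_singleton.1 hk), hne, hsq⟩

variable {α : R}

theorem IsCohenMacaulayLocal.mem_nonZeroDivisors_of_sq_eq (hCM : IsCohenMacaulayLocal R)
    (hdim : ringKrullDim R = 1)
    (hα2 : maximalIdeal R ^ 2 = Ideal.span {α} * maximalIdeal R) : α ∈ R⁰ := by
  obtain ⟨t, htm, ht0⟩ := hCM.exists_mem_nonZeroDivisors hdim
  exact mem_nonZeroDivisors_of_dvd_pow ht0
    (Ideal.mem_span_singleton.1 (Ideal.mul_le_left (hα2 ▸ Ideal.pow_mem_pow htm 2)))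

theorem IsUlrich.exists_hasPowerReduction (hI : IsUlrich I) (hCM : IsCohenMacaulayLocal R)
    (hdim : ringKrullDim R = 1) (hα : α ∈ maximalIdeal R)
    (hα2 : maximalIdeal R ^ 2 = Ideal.span {α} * maximalIdeal R) :
    ∃ ℓ, HasPowerReduction α ℓ I := by
  have := hCM.1
  have := hI.free
  have hα0 := hCM.mem_nonZeroDivisors_of_sq_eq hdim hα2
  obtain ⟨a, haI, ha0, hne, hsq⟩ := hI.exists_sq_eq hCM hdim
  obtain ⟨n, x, hw⟩ := exists_isCotangentBasis_cons hI.le_maximalIdeal haI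
    (notMem_maximalIdeal_mul ha0 haI hsq)
  have hn : n ≠ 0 :=
    (hw.eq_span_singleton_iff (ne_top_of_le_ne_top Ideal.IsPrime.ne_top' hI.le_maximalIdeal)).not.1
      hne
  exact hw.exists_hasPowerReduction hn hI.radical_eq hα hα0 hα2 ha0 hsq

theorem HasPowerReduction.exists_isCotangentBasis [IsNoetherianRing R] {ℓ : ℕ}
    (h : HasPowerReduction α ℓ I) (hα0 : α ∈ R⁰) [Module.Free (R ⧸ I) I.Cotangent] :
    ∃ x : Fin (embDim R - 1) → R,
      IsCotangentBasis I (Fin.cons (α ^ ℓ) x : Fin (embDim R - 1 + 1) → R) := by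
  obtain ⟨n, x, hw⟩ := exists_isCotangentBasis_cons h.le_maximalIdeal h.pow_mem
    (notMem_maximalIdeal_mul (pow_mem hα0 ℓ) h.pow_mem h.sq_eq)
  obtain rfl : n = embDim R - 1 := by rw [h.embDim_eq hw, Nat.add_sub_cancel]
  exact ⟨x, hw⟩

end Ulrich

end UlrichChain

open UlrichChain in
theorem theorem5p4 {R : Type*} [CommRing R] [IsLocalRing R]
    (hCM : IsCohenMacaulayLocal R) (hdim : ringKrullDim R = 1)
    (K : Type*) [CommRing K] [Algebra R K] [IsFractionRing R K]
    (e : ℕ) (he : HasMultiplicity R e) (hv : embDim R = e) (he1 : 1 < e)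
    (α : R) (hα : α ∈ maximalIdeal R)
    (hα2 : maximalIdeal R ^ 2 = Ideal.span {α} * maximalIdeal R)
    (I : Ideal R) (hI : IsUlrich I) :
    -- a composition series consisting of Ulrich ideals exists
    (∃ (ℓ : ℕ) (c : ℕ → Ideal R), IsCompSeries I ℓ c ∧ ∀ i, 1 ≤ i → i ≤ ℓ → IsUlrich (c i)) ∧
    ∀ (ℓ : ℕ) (c : ℕ → Ideal R), IsCompSeries I ℓ c →
      (∀ i, 1 ≤ i → i ≤ ℓ → IsUlrich (c i)) →
      Module.length R (R ⧸ I) = (ℓ : ℕ∞) ∧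
      -- the tower of birational finite extensions
      (∀ i, i < ℓ → overring K c i < overring K c (i + 1)) ∧
      overring K c ℓ ≤ integralClosure R K ∧
      (∀ i, i ≤ ℓ → Module.Finite R (overring K c i)) ∧
      -- (1)
      (∀ i, 1 ≤ i → i ≤ ℓ → IsReduction (Ideal.span {α ^ i}) (c i)) ∧
      -- (2)
      (∀ i, 1 ≤ i → i ≤ ℓ →
        overring K c i = selfColon (jacobsonSubmodule (overring K c (i - 1)))) ∧
      -- (3)
      (∀ i, i < ℓ → ∃ _ : IsLocalRing (overring K c i),
        jacobsonRadical (overring K c i) = maximalIdeal (overring K c i) ∧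
        IsCohenMacaulayLocal (overring K c i) ∧
        ringKrullDim (overring K c i) = 1 ∧
        embDim (overring K c i) = e ∧
        HasMultiplicity (overring K c i) e ∧
        jacobsonRadical (overring K c i) ^ 2 =
          Ideal.span {algebraMap R (overring K c i) α} * jacobsonRadical (overring K c i)) ∧
      -- (4)
      (∃ x : Fin (embDim R - 1) → R, (∀ j, x j ∈ I) ∧
        I = Ideal.span (insert (α ^ ℓ) (Set.range x))) ∧
      (∀ x : Fin (embDim R - 1) → R, (∀ j, x j ∈ I) →
        I = Ideal.span (insert (α ^ ℓ) (Set.range x)) →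
        (∀ i, 1 ≤ i → i ≤ ℓ → c i = Ideal.span (insert (α ^ i) (Set.range x))) ∧
        maximalIdeal R = Ideal.span (insert α (Set.range x))) ∧
      (∀ (n : ℕ) (d : ℕ → Ideal R), IsCompSeries I n d →
        n = ℓ ∧ ∀ i, 1 ≤ i → i ≤ ℓ → d i = c i) ∧
      -- (5)
      (∀ J : Ideal R, I ≤ J → J ≤ maximalIdeal R → ∃ i, 1 ≤ i ∧ i ≤ ℓ ∧ J = c i) := by
  have hnoeth := hCM.1
  have hfree := hI.free
  have hα0 := hCM.mem_nonZeroDivisors_of_sq_eq hdim hα2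
  obtain ⟨k, h⟩ := hI.exists_hasPowerReduction hCM hdim hα hα2
  obtain ⟨x, hw⟩ := h.exists_isCotangentBasis hα0
  have hn : embDim R - 1 ≠ 0 := by lia
  refine ⟨⟨k, _, h.isCompSeries, fun i => h.isUlrich_chainIdeal hw hn hdim⟩, fun ℓ c hc _ => ?_⟩
  obtain ⟨rfl, hci⟩ := h.isCompSeries.unique (fun J => h.exists_eq_chainIdeal_of_le) hc
  have hB {i : ℕ} (hi : i ≤ ℓ) : overring K c i = overring K (chainIdeal α I) i :=
    overring_congr hci hi
  have hall (J : Ideal R) := h.exists_eq_of_isCompSeries hc (J := J)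
  refine ⟨hc.last ▸ hc.length_quotient hc.one_le le_rfl, fun i hi => ?_, ?_, fun i hi => ?_,
    fun i hi1 hi => ?_, fun i hi1 hi => ?_, fun i hi => ?_, ?_, fun y _ hy => ?_,
    fun _ _ => hc.unique hall, hall⟩
  · exact hB hi.le ▸ hB hi ▸ h.overring_lt hα0 hw hn hi
  · have := finite_overring_chainIdeal (K := K) (I := I) hα0 ℓ
    exact hB le_rfl ▸ le_integralClosure_of_finite _
  · exact hB hi ▸ finite_overring_chainIdeal hα0 i
  · exact hci i hi1 hi ▸ h.isReduction_chainIdeal hi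
  · obtain ⟨i, rfl⟩ := Nat.exists_eq_add_of_le' hi1
    rw [hB hi, Nat.add_sub_cancel, hB (Nat.le_of_succ_le hi),
      h.selfColon_jacobsonSubmodule_overring hα0 hi]
  · exact hB hi.le ▸ hv ▸ h.exists_isLocalRing_overring hα0 hw hi
  · exact ⟨x, hw.mem_tail, (IsCotangentBasis.cons_iff.1 hw).1.symm⟩
  · refine ⟨fun i hi1 hi => (hci i hi1 hi).trans (chainIdeal_eq_span_insert hy hi), ?_⟩
    rw [← h.chainIdeal_one, chainIdeal_eq_span_insert hy h.one_le, pow_one]
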